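/- Let $R$ be a commutative noetherian local ring with residue field $k$. For a finitely generated $R$-module $M$, let $\operatorname{depth} M=\inf\{i\ge 0 : \operatorname{Ext}^i_R(k,M)\ne 0\}$ (so the zero module has depth $\infty$), and write $M^*=\operatorname{Hom}_R(M,R)$. Write $\operatorname{Ext}_R^{>0}(M,R)=0$ if $\operatorname{Ext}_R^i(M,R)=0$ for all $i>0$. A finitely generated $R$-module $M$ is called totally reflexive if the natural map $M\to M^{**}$ is an isomorphism and $\operatorname{Ext}_R^{>0}(M,R)=0=\operatorname{Ext}_R^{>0}(M^*,R)$. Assume that $\operatorname{depth} R>0$. Then the following are equivalent. (1) Every finitely generated $R$-module $M$ with $\operatorname{Ext}_R^{>0}(M,R)=0$ is totally reflexive; that is, $R$ satisfies $(\mathbf{tr})$. (2) Every finitely generated $R$-module $M$ with $\operatorname{Ext}_R^{>0}(M,R)=0$ satisfies $\operatorname{depth} M>0$. In particular, the following question of Araya has an affirmative answer for $R$ if and only if $R$ satisfies $(\mathbf{tr})$: if a local ring $R$ has positive depth and $M$ is a finitely generated $R$-module with $\operatorname{Ext}_R^{>0}(M,R)=0$, must $M$ have positive depth? -/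

import Mathlib

universe u

open CategoryTheory

noncomputable section

/-- `Ext^i_R(M, R) = 0` for all `i > 0`. -/
def ExtPosVanishes (R : Type u) [CommRing R] (M : Type u) [AddCommGroup M] [Module R M] : Prop :=
  ∀ i : ℕ, 0 < i → Subsingleton (Abelian.Ext (ModuleCat.of R M) (ModuleCat.of R R) i)

/-- A (finitely generated) module `M` is totally reflexive if the natural map `M → M**` is
bijective and `Ext^{>0}_R(M, R) = 0 = Ext^{>0}_R(M*, R)`. -/
structure IsTotallyReflexive (R : Type u) [CommRing R] (M : Type u) [AddCommGroup M]
    [Module R M] : Prop where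
  bijective_eval : Function.Bijective (Module.Dual.eval R M)
  ext_vanishes : ExtPosVanishes R M
  ext_dual_vanishes : ExtPosVanishes R (Module.Dual R M)

/-- The condition (tr): every finitely generated module `M` with `Ext^{>0}_R(M, R) = 0` is totally
reflexive. -/
def SatisfiesTR (R : Type u) [CommRing R] : Prop :=
  ∀ (M : Type u) [AddCommGroup M] [Module R M] [Module.Finite R M],
    ExtPosVanishes R M → IsTotallyReflexive R M

/-- The depth of a finitely generated module `M` over a noetherian local ring `R` with residue
field `k`: the infimum in `ℕ ∪ {∞}` of the `i` with `Ext^i_R(k, M) ≠ 0`. In particular the zero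
module has depth `∞`. -/
def moduleDepth (R : Type u) [CommRing R] [IsLocalRing R] (M : Type u) [AddCommGroup M]
    [Module R M] : ℕ∞ :=
  ⨅ (i : ℕ) (_ : Nontrivial
    (Abelian.Ext (ModuleCat.of R (IsLocalRing.ResidueField R)) (ModuleCat.of R M) i)), (i : ℕ∞)

/-- Araya's question for `R` has an affirmative answer: if `R` has positive depth, then every
finitely generated module `M` with `Ext^{>0}_R(M, R) = 0` has positive depth. -/
def ArayaAffirmative (R : Type u) [CommRing R] [IsLocalRing R] : Prop :=
  0 < moduleDepth R R →
    ∀ (M : Type u) [AddCommGroup M] [Module R M] [Module.Finite R M],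
      ExtPosVanishes R M → 0 < moduleDepth R M

end


/-!
Torsionlessness suffices for `(tr)`: a torsionless `M` with `Ext^{>0}(M, R) = 0` embeds in a free
module `F` such that `F* → M*` is surjective. The cokernel `C` again satisfies
`Ext^{>0}(C, R) = 0`, hence is torsionless. A diagram chase then gives reflexivity of `M`, and
`0 → C* → F* → M* → 0` shifts the vanishing of `Ext^{>0}(M*, R)` down to degree one, where it
follows from reflexivity of `C`.

To see that `M` is torsionless when all such modules have positive depth, choose an `M`-regular `x`
in the maximal ideal and a map `f : M → F` with `F` free and `F* → M*` surjective, so that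
`K = ker (M → M**)` is the kernel of `f`. If multiplication by `x` on `M` factors through a free
module, then `x K = 0` and regularity gives `K = 0`. Otherwise let `P` be the pushout of `f` along
multiplication by `x`. It satisfies `Ext^{>0}(P, R) = 0`, and the ideal of scalars whose
multiplication factors through a free module is strictly larger for `P` than for `M`, so by
noetherian induction `P` is torsionless. Hence `K` vanishes in `P`, which means `K = x K`, and
Nakayama's lemma applies.
-/

section ShortExact

variable {𝒜 : Type*} [Category 𝒜] [Abelian 𝒜] [HasExt 𝒜] {S : ShortComplex 𝒜}

theorem subsingleton_ext_X₂ (hS : S.ShortExact) (Y : 𝒜) {i : ℕ}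
    (h₁ : Subsingleton (Abelian.Ext S.X₁ Y i)) (h₃ : Subsingleton (Abelian.Ext S.X₃ Y i)) :
    Subsingleton (Abelian.Ext S.X₂ Y i) := by
  refine subsingleton_of_forall_eq 0 fun e => ?_
  obtain ⟨c, rfl⟩ := Abelian.Ext.contravariant_sequence_exact₂ hS Y e (Subsingleton.elim _ _)
  rw [Subsingleton.elim c 0, Abelian.Ext.comp_zero]

theorem subsingleton_ext_X₃_succ (hS : S.ShortExact) (Y : 𝒜) {i : ℕ}
    (h₁ : Subsingleton (Abelian.Ext S.X₁ Y i)) (h₂ : Subsingleton (Abelian.Ext S.X₂ Y (i + 1))) :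
    Subsingleton (Abelian.Ext S.X₃ Y (i + 1)) := by
  refine subsingleton_of_forall_eq 0 fun e => ?_
  obtain ⟨a, rfl⟩ := Abelian.Ext.contravariant_sequence_exact₃ hS Y e (Subsingleton.elim _ _)
    (add_comm 1 i)
  rw [Subsingleton.elim a 0, Abelian.Ext.comp_zero]

theorem subsingleton_ext_X₃_one (hS : S.ShortExact) (Y : 𝒜)
    (hext : Function.Surjective fun ψ : S.X₂ ⟶ Y => S.f ≫ ψ)
    (h₂ : Subsingleton (Abelian.Ext S.X₂ Y 1)) : Subsingleton (Abelian.Ext S.X₃ Y 1) := by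
  refine subsingleton_of_forall_eq 0 fun e => ?_
  obtain ⟨a, rfl⟩ := Abelian.Ext.contravariant_sequence_exact₃ hS Y e (Subsingleton.elim _ _)
    (add_zero 1)
  obtain ⟨ψ, hψ⟩ := hext (Abelian.Ext.homEquiv₀ a)
  rw [← Abelian.Ext.mk₀_homEquiv₀_apply a, ← hψ, ← Abelian.Ext.mk₀_comp_mk₀,
    hS.extClass_comp_assoc]

end ShortExact

section ExtModule

variable {R : Type u} [CommRing R]
  {A B C : Type u} [AddCommGroup A] [Module R A] [AddCommGroup B] [Module R B]
  [AddCommGroup C] [Module R C] {f : A →ₗ[R] B} {g : B →ₗ[R] C}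

theorem shortExact_of_function_exact (hf : Function.Injective f) (hg : Function.Surjective g)
    (hfg : Function.Exact f g) :
    (ModuleCat.shortComplexOfCompEqZero f g hfg.linearMap_comp_eq_zero).ShortExact :=
  ModuleCat.shortComplex_shortExact _ hfg hf hg

theorem subsingleton_ext_one_of_surjective_dualMap (hf : Function.Injective f)
    (hg : Function.Surjective g) (hfg : Function.Exact f g) (hext : Function.Surjective f.dualMap)
    (hB : Subsingleton (Abelian.Ext (ModuleCat.of R B) (ModuleCat.of R R) 1)) :
    Subsingleton (Abelian.Ext (ModuleCat.of R C) (ModuleCat.of R R) 1) := by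
  refine subsingleton_ext_X₃_one (shortExact_of_function_exact hf hg hfg) _ (fun φ => ?_) hB
  obtain ⟨ψ, hψ⟩ := hext φ.hom
  exact ⟨ModuleCat.ofHom ψ, ModuleCat.hom_ext hψ⟩

theorem ExtPosVanishes.of_projective [Module.Projective R A] : ExtPosVanishes R A := by
  intro i hi
  obtain ⟨j, rfl⟩ := Nat.exists_eq_succ_of_ne_zero hi.ne'
  have : Projective (ModuleCat.of R A) := (IsProjective.iff_projective A).1 inferInstance
  exact Abelian.Ext.subsingleton_of_projective _ _ _

theorem ExtPosVanishes.prod (hA : ExtPosVanishes R A) (hB : ExtPosVanishes R B) :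
    ExtPosVanishes R (A × B) := fun i hi =>
  subsingleton_ext_X₂ (shortExact_of_function_exact LinearMap.inl_injective
    LinearMap.snd_surjective Function.Exact.inl_snd) _ (hA i hi) (hB i hi)

theorem ExtPosVanishes.of_exact (hf : Function.Injective f) (hg : Function.Surjective g)
    (hfg : Function.Exact f g) (hext : Function.Surjective f.dualMap)
    (hA : ExtPosVanishes R A) (hB : ExtPosVanishes R B) : ExtPosVanishes R C
  | 1, hi => subsingleton_ext_one_of_surjective_dualMap hf hg hfg hext (hB 1 hi)
  | i + 2, hi => subsingleton_ext_X₃_succ (shortExact_of_function_exact hf hg hfg) _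
      (hA (i + 1) i.succ_pos) (hB (i + 2) hi)

end ExtModule

theorem moduleDepth_pos_iff_exists_isSMulRegular {R : Type u} [CommRing R] [IsNoetherianRing R]
    [IsLocalRing R] {M : Type u} [AddCommGroup M] [Module R M] [Module.Finite R M] :
    0 < moduleDepth R M ↔ ∃ x ∈ IsLocalRing.maximalIdeal R, IsSMulRegular M x := by
  have depth_pos_iff_ext_zero : 0 < moduleDepth R M ↔ Subsingleton (Abelian.Ext
      (ModuleCat.of R (IsLocalRing.ResidueField R)) (ModuleCat.of R M) 0) := by
    simp [moduleDepth, pos_iff_ne_zero, not_nontrivial_iff_subsingleton]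
  have annihilator_residueField : Module.annihilator R (IsLocalRing.ResidueField R) =
      IsLocalRing.maximalIdeal R := Ideal.annihilator_quotient
  have : Module.Finite R (IsLocalRing.ResidueField R) :=
    inferInstanceAs (Module.Finite R (R ⧸ IsLocalRing.maximalIdeal R))
  rw [depth_pos_iff_ext_zero, Abelian.Ext.addEquiv₀.subsingleton_congr,
    ModuleCat.homAddEquiv.subsingleton_congr, ← annihilator_residueField]
  exact IsSMulRegular.subsingleton_linearMap_iff

section Duality

variable {R : Type*} [CommRing R] {M F C : Type*} [AddCommGroup M] [Module R M]
  [AddCommGroup F] [Module R F] [AddCommGroup C] [Module R C] {f : M →ₗ[R] F} {g : F →ₗ[R] C}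

theorem isSMulRegular_of_injective_eval {x : R} (hx : IsSMulRegular R x)
    (hM : Function.Injective (Module.Dual.eval R M)) : IsSMulRegular M x := by
  refine fun m m' h => hM (LinearMap.ext fun φ => hx ?_)
  change x • φ m = x • φ m'
  rw [← map_smul, ← map_smul]
  exact congrArg φ h

theorem exists_surjective_dualMap (R M : Type*) [CommRing R] [AddCommGroup M] [Module R M]
    [Module.Finite R (Module.Dual R M)] :
    ∃ (n : ℕ) (f : M →ₗ[R] Fin n → R), Function.Surjective f.dualMap := by
  obtain ⟨n, φ, hφ⟩ := Module.Finite.exists_fin (R := R) (M := Module.Dual R M)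
  refine ⟨n, LinearMap.pi φ, ?_⟩
  rw [← LinearMap.range_eq_top, eq_top_iff, ← hφ, Submodule.span_le]
  rintro _ ⟨i, rfl⟩
  exact ⟨LinearMap.proj i, rfl⟩

theorem ker_eval_eq_ker (hf : Function.Surjective f.dualMap)
    (hF : Function.Injective (Module.Dual.eval R F)) :
    LinearMap.ker (Module.Dual.eval R M) = LinearMap.ker f := by
  have hdual : Function.Injective f.dualMap.dualMap :=
    LinearMap.dualMap_injective_of_surjective hf
  rw [← LinearMap.ker_comp_of_ker_eq_bot _ (LinearMap.ker_eq_bot.2 hdual),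
    Module.Dual.eval_naturality, LinearMap.ker_comp_of_ker_eq_bot _ (LinearMap.ker_eq_bot.2 hF)]

theorem surjective_eval_of_exact (hf : Function.Surjective f.dualMap) (hfg : Function.Exact f g)
    (hF : Function.Surjective (Module.Dual.eval R F))
    (hC : Function.Injective (Module.Dual.eval R C)) :
    Function.Surjective (Module.Dual.eval R M) := by
  intro θ
  obtain ⟨a, ha⟩ := hF (f.dualMap.dualMap θ)
  have apply_a (ψ : Module.Dual R F) : ψ a = θ (f.dualMap ψ) := LinearMap.congr_fun ha ψ
  have ga_eq_zero : g a = 0 := (injective_iff_map_eq_zero _).1 hC _ <| LinearMap.ext fun ψ => by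
    have : f.dualMap (g.dualMap ψ) = 0 :=
      LinearMap.ext fun m => by simp [hfg.apply_apply_eq_zero]
    simpa [this] using apply_a (g.dualMap ψ)
  obtain ⟨m, rfl⟩ := (hfg a).1 ga_eq_zero
  refine ⟨m, LinearMap.ext fun φ => ?_⟩
  obtain ⟨ψ, rfl⟩ := hf φ
  exact apply_a ψ

theorem exact_dualMap (hg : Function.Surjective g) (hfg : Function.Exact f g) :
    Function.Exact g.dualMap f.dualMap :=
  LinearMap.exact_lcomp_of_exact_of_surjective R hfg hg

theorem surjective_dualMap_dualMap (hg : Function.Surjective g)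
    (hC : Function.Surjective (Module.Dual.eval R C)) : Function.Surjective g.dualMap.dualMap :=
  .of_comp (g := Module.Dual.eval R F) (hC.comp hg)

end Duality

section StableAnnihilator

variable {R : Type*} [CommRing R] {M N F : Type*} [AddCommGroup M] [Module R M]
  [AddCommGroup N] [Module R N] [AddCommGroup F] [Module R F] {f : M →ₗ[R] F}

theorem comp_mem_range_dualTensorHom [Module.Finite R F] [Module.Projective R F]
    (u : M →ₗ[R] F) (v : F →ₗ[R] N) : v ∘ₗ u ∈ LinearMap.range (dualTensorHom R M N) := by
  obtain ⟨t, rfl⟩ := dualTensorHom_bijective.2 v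
  exact ⟨_, LinearMap.congr_fun (dualTensorHom_comp_rTensor_dualMap u) t⟩

theorem exists_comp_eq_of_mem_range_dualTensorHom (hf : Function.Surjective f.dualMap)
    {h : M →ₗ[R] N} (hh : h ∈ LinearMap.range (dualTensorHom R M N)) :
    ∃ β : F →ₗ[R] N, β ∘ₗ f = h := by
  obtain ⟨t, rfl⟩ := hh
  obtain ⟨s, rfl⟩ := LinearMap.rTensor_surjective N hf t
  exact ⟨dualTensorHom R F N s,
    (LinearMap.congr_fun (dualTensorHom_comp_rTensor_dualMap f) s).symm⟩

theorem apply_eq_zero_of_mem_range_dualTensorHom {h : M →ₗ[R] N}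
    (hh : h ∈ LinearMap.range (dualTensorHom R M N)) {m : M} (hm : Module.Dual.eval R M m = 0) :
    h m = 0 := by
  obtain ⟨t, rfl⟩ := hh
  induction t with
  | zero => simp
  | tmul φ n =>
    have : φ m = 0 := LinearMap.congr_fun hm φ
    simp [this]
  | add s t hs ht => simp [hs, ht]

/-- The annihilator of `M` in the stable module category: the scalars whose multiplication on `M`
factors through a free module of finite rank, the maps with such a factorization being encoded as
the image of `M* ⊗ M` in `End M`. It measures the progress of the noetherian induction. -/
def stableAnnihilator (R M : Type*) [CommRing R] [AddCommGroup M] [Module R M] : Ideal R :=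
  (LinearMap.range (dualTensorHom R M M)).colon {LinearMap.id}

theorem mem_stableAnnihilator {y : R} :
    y ∈ stableAnnihilator R M ↔
      y • (LinearMap.id : M →ₗ[R] M) ∈ LinearMap.range (dualTensorHom R M M) :=
  Submodule.mem_colon_singleton

theorem injective_eval_of_mem_stableAnnihilator {x : R} (hx : IsSMulRegular M x)
    (hxM : x ∈ stableAnnihilator R M) : Function.Injective (Module.Dual.eval R M) :=
  (injective_iff_map_eq_zero _).2 fun _ hm => hx.right_eq_zero_of_smul
    (apply_eq_zero_of_mem_range_dualTensorHom (mem_stableAnnihilator.1 hxM) hm)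

end StableAnnihilator

section SMulPushout

variable {R : Type*} [CommRing R] {M F N : Type*} [AddCommGroup M] [Module R M]
  [AddCommGroup F] [Module R F] [AddCommGroup N] [Module R N] (f : M →ₗ[R] F) (x : R)

/-- The map `m ↦ (f m, -x m)`, whose cokernel is the pushout of `f` along multiplication by `x`;
it is injective for `M`-regular `x`. -/
def smulPushoutRelation : M →ₗ[R] F × M := f.prod (-(x • LinearMap.id))

/-- The pushout of `f : M → F` along multiplication by `x` on `M`, encoded as the quotient of
`F × M` by the elements `(f m, -x m)`. It replaces `M` by a module with a larger stable
annihilator. -/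
abbrev SMulPushout : Type _ := (F × M) ⧸ LinearMap.range (smulPushoutRelation f x)

namespace SMulPushout

/-- The coprojection of `F` into the pushout. -/
def inl : F →ₗ[R] SMulPushout f x := Submodule.mkQ _ ∘ₗ LinearMap.inl R F M

/-- The coprojection into the pushout of the copy of `M` that is the target of multiplication by
`x`. -/
def inr : M →ₗ[R] SMulPushout f x := Submodule.mkQ _ ∘ₗ LinearMap.inr R F M

variable {f x}

theorem inl_apply_eq (m : M) : inl f x (f m) = x • inr f x m := by
  rw [← map_smul]
  refine (Submodule.Quotient.eq _).2 ⟨m, ?_⟩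
  simp [smulPushoutRelation]

theorem hom_ext {u v : SMulPushout f x →ₗ[R] N} (hl : u ∘ₗ inl f x = v ∘ₗ inl f x)
    (hr : u ∘ₗ inr f x = v ∘ₗ inr f x) : u = v :=
  Submodule.linearMap_qext _ (LinearMap.prod_ext hl hr)

theorem exists_desc (u : F →ₗ[R] N) (v : M →ₗ[R] N) (h : ∀ m, u (f m) = x • v m) :
    ∃ w : SMulPushout f x →ₗ[R] N, w ∘ₗ inl f x = u ∧ w ∘ₗ inr f x = v := by
  refine ⟨Submodule.liftQ _ (u.coprod v) ?_, ?_, ?_⟩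
  · rintro _ ⟨m, rfl⟩
    simp [smulPushoutRelation, h]
  · ext; simp [inl]
  · ext; simp [inr]

theorem relation_injective (hx : IsSMulRegular M x) :
    Function.Injective (smulPushoutRelation f x) := fun _ _ h =>
  hx (neg_injective (congrArg Prod.snd h))

theorem relation_dualMap_surjective (hf : Function.Surjective f.dualMap) :
    Function.Surjective (smulPushoutRelation f x).dualMap := by
  intro φ
  obtain ⟨ψ, rfl⟩ := hf φ
  exact ⟨ψ ∘ₗ LinearMap.fst R F M, rfl⟩

theorem exists_smul_eq_of_inr_eq_zero {m : M} (hm : inr f x m = 0) :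
    ∃ z ∈ LinearMap.ker f, x • z = m := by
  obtain ⟨z, hz⟩ := (Submodule.Quotient.mk_eq_zero _).1 hm
  have f_z : f z = 0 := congrArg Prod.fst hz
  have neg_smul_z : -(x • z) = m := congrArg Prod.snd hz
  exact ⟨-z, by simp [f_z], by rw [smul_neg, neg_smul_z]⟩

theorem ker_eval_le_smul (hf : Function.Surjective f.dualMap)
    (hF : Function.Injective (Module.Dual.eval R F))
    (hP : Function.Injective (Module.Dual.eval R (SMulPushout f x))) :
    LinearMap.ker (Module.Dual.eval R M) ≤
      Ideal.span {x} • LinearMap.ker (Module.Dual.eval R M) := by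
  intro m hm
  have inr_eq_zero : inr f x m = 0 := (injective_iff_map_eq_zero _).1 hP _ <| by
    rw [← LinearMap.comp_apply, ← Module.Dual.eval_naturality, LinearMap.comp_apply,
      LinearMap.mem_ker.1 hm, map_zero]
  obtain ⟨z, hz, rfl⟩ := exists_smul_eq_of_inr_eq_zero inr_eq_zero
  rw [← ker_eval_eq_ker hf hF] at hz
  exact Submodule.smul_mem_smul (Ideal.mem_span_singleton_self x) hz

theorem injective_eval_of_mem_jacobson [IsNoetherian R M] (hx : x ∈ Ring.jacobson R)
    (hf : Function.Surjective f.dualMap) (hF : Function.Injective (Module.Dual.eval R F))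
    (hP : Function.Injective (Module.Dual.eval R (SMulPushout f x))) :
    Function.Injective (Module.Dual.eval R M) := by
  rw [← LinearMap.ker_eq_bot]
  refine Submodule.eq_bot_of_le_smul_of_le_jacobson_bot _ _ (IsNoetherian.noetherian _)
    (ker_eval_le_smul hf hF hP) ?_
  rwa [Ideal.jacobson_bot, Ideal.span_singleton_le_iff_mem]

theorem exists_comp_inl_eq_smul_id (f : M →ₗ[R] F) (x : R) :
    ∃ p : SMulPushout f x →ₗ[R] F, p ∘ₗ inl f x = x • LinearMap.id ∧ p ∘ₗ inr f x = f :=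
  exists_desc (x • LinearMap.id) f fun _ => rfl

variable [Module.Finite R F] [Module.Projective R F]

theorem mem_stableAnnihilator_self : x ∈ stableAnnihilator R (SMulPushout f x) := by
  obtain ⟨p, hpl, hpr⟩ := exists_comp_inl_eq_smul_id f x
  have smul_id_eq : x • LinearMap.id = inl f x ∘ₗ p := by
    refine hom_ext ?_ ?_
    · ext a
      simp [LinearMap.comp_assoc, hpl]
    · ext m
      simp [LinearMap.comp_assoc, hpr, inl_apply_eq]
  rw [mem_stableAnnihilator, smul_id_eq]
  exact comp_mem_range_dualTensorHom _ _

theorem stableAnnihilator_le (hf : Function.Surjective f.dualMap) :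
    stableAnnihilator R M ≤ stableAnnihilator R (SMulPushout f x) := by
  intro y hy
  obtain ⟨β, hβ⟩ := exists_comp_eq_of_mem_range_dualTensorHom hf (mem_stableAnnihilator.1 hy)
  have β_apply (m : M) : β (f m) = y • m := LinearMap.congr_fun hβ m
  obtain ⟨p, hpl, hpr⟩ := exists_comp_inl_eq_smul_id f x
  obtain ⟨q, hql, hqr⟩ := exists_desc (f := f) (x := x) (y • LinearMap.id - f ∘ₗ β) 0
    fun m => by simp [β_apply]
  have smul_id_eq : y • LinearMap.id = inl f x ∘ₗ q + (inr f x ∘ₗ β) ∘ₗ p := by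
    refine hom_ext ?_ ?_
    · ext a
      simp [LinearMap.add_comp, LinearMap.comp_assoc, hpl, hql, inl_apply_eq]
    · ext m
      simp [LinearMap.add_comp, LinearMap.comp_assoc, hpr, hqr, β_apply]
  rw [mem_stableAnnihilator, smul_id_eq]
  exact add_mem (comp_mem_range_dualTensorHom _ _) (comp_mem_range_dualTensorHom _ _)

theorem stableAnnihilator_lt (hf : Function.Surjective f.dualMap)
    (hxM : x ∉ stableAnnihilator R M) :
    stableAnnihilator R M < stableAnnihilator R (SMulPushout f x) :=
  (stableAnnihilator_le hf).lt_of_not_ge fun h => hxM (h mem_stableAnnihilator_self)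

end SMulPushout

theorem ExtPosVanishes.smulPushout {R M F : Type u} [CommRing R] [AddCommGroup M] [Module R M]
    [AddCommGroup F] [Module R F] {f : M →ₗ[R] F} {x : R} (hf : Function.Surjective f.dualMap)
    (hx : IsSMulRegular M x) (hM : ExtPosVanishes R M) (hF : ExtPosVanishes R F) :
    ExtPosVanishes R (SMulPushout f x) :=
  .of_exact (SMulPushout.relation_injective hx) (Submodule.mkQ_surjective _)
    (LinearMap.exact_map_mkQ_range _) (SMulPushout.relation_dualMap_surjective hf) hM (hF.prod hM)

end SMulPushout

theorem injective_eval_of_exists_isSMulRegular {R : Type u} [CommRing R] [IsNoetherianRing R]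
    (exists_regular : ∀ (M : Type u) [AddCommGroup M] [Module R M] [Module.Finite R M],
      ExtPosVanishes R M → ∃ x ∈ Ring.jacobson R, IsSMulRegular M x)
    (M : Type u) [AddCommGroup M] [Module R M] [Module.Finite R M] (hM : ExtPosVanishes R M) :
    Function.Injective (Module.Dual.eval R M) := by
  induction hJ : stableAnnihilator R M using WellFoundedGT.induction generalizing M with
  | ind J ih =>
    subst hJ
    obtain ⟨x, hxJac, hx⟩ := exists_regular M hM
    by_cases hxM : x ∈ stableAnnihilator R M
    · exact injective_eval_of_mem_stableAnnihilator hx hxM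
    · obtain ⟨n, f, hf⟩ := exists_surjective_dualMap R M
      have hP : Function.Injective (Module.Dual.eval R (SMulPushout f x)) :=
        ih _ (SMulPushout.stableAnnihilator_lt hf hxM) _ (hM.smulPushout hf hx .of_projective) rfl
      exact SMulPushout.injective_eval_of_mem_jacobson hxJac hf
        (Module.bijective_dual_eval R _).1 hP

theorem exists_extPosVanishes_quotient_range {R M : Type u} [CommRing R] [AddCommGroup M]
    [Module R M] [Module.Finite R (Module.Dual R M)]
    (eval_injective : Function.Injective (Module.Dual.eval R M)) (hM : ExtPosVanishes R M) :
    ∃ (n : ℕ) (f : M →ₗ[R] Fin n → R), Function.Surjective f.dualMap ∧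
      ExtPosVanishes R ((Fin n → R) ⧸ LinearMap.range f) := by
  obtain ⟨n, f, hf⟩ := exists_surjective_dualMap R M
  have f_injective : Function.Injective f := by
    rw [← LinearMap.ker_eq_bot, ← ker_eval_eq_ker hf (Module.bijective_dual_eval R _).1,
      LinearMap.ker_eq_bot]
    exact eval_injective
  exact ⟨n, f, hf, .of_exact f_injective (Submodule.mkQ_surjective _)
    (LinearMap.exact_map_mkQ_range _) hf hM .of_projective⟩

section Torsionless

variable {R : Type u} [CommRing R] [IsNoetherianRing R]
  (injective_eval : ∀ (M : Type u) [AddCommGroup M] [Module R M] [Module.Finite R M],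
    ExtPosVanishes R M → Function.Injective (Module.Dual.eval R M))
  (M : Type u) [AddCommGroup M] [Module R M] [Module.Finite R M] (hM : ExtPosVanishes R M)

include injective_eval hM

theorem bijective_eval_of_injective_eval : Function.Bijective (Module.Dual.eval R M) := by
  obtain ⟨n, f, hf, hC⟩ := exists_extPosVanishes_quotient_range (injective_eval M hM) hM
  exact ⟨injective_eval M hM, surjective_eval_of_exact hf (LinearMap.exact_map_mkQ_range f)
    (Module.bijective_dual_eval R _).2 (injective_eval _ hC)⟩

theorem subsingleton_ext_dual_of_injective_eval (i : ℕ) : Subsingleton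
    (Abelian.Ext (ModuleCat.of R (Module.Dual R M)) (ModuleCat.of R R) (i + 1)) := by
  induction i generalizing M with
  | zero =>
    obtain ⟨n, f, hf, hC⟩ := exists_extPosVanishes_quotient_range (injective_eval M hM) hM
    have hg := (LinearMap.range f).mkQ_surjective
    exact subsingleton_ext_one_of_surjective_dualMap
      (LinearMap.dualMap_injective_of_surjective hg) hf
      (exact_dualMap hg (LinearMap.exact_map_mkQ_range f))
      (surjective_dualMap_dualMap hg (bijective_eval_of_injective_eval injective_eval _ hC).2)
      (ExtPosVanishes.of_projective 1 one_pos)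
  | succ i ih =>
    obtain ⟨n, f, hf, hC⟩ := exists_extPosVanishes_quotient_range (injective_eval M hM) hM
    have hg := (LinearMap.range f).mkQ_surjective
    exact subsingleton_ext_X₃_succ (shortExact_of_function_exact
      (LinearMap.dualMap_injective_of_surjective hg) hf
      (exact_dualMap hg (LinearMap.exact_map_mkQ_range f))) _
      (ih _ hC) (ExtPosVanishes.of_projective _ (Nat.succ_pos _))

end Torsionless

theorem satisfiesTR_iff_injective_eval {R : Type u} [CommRing R] [IsNoetherianRing R] :
    SatisfiesTR R ↔ ∀ (M : Type u) [AddCommGroup M] [Module R M] [Module.Finite R M],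
      ExtPosVanishes R M → Function.Injective (Module.Dual.eval R M) := by
  refine ⟨fun h M _ _ _ hM => (h M hM).bijective_eval.1, fun h M _ _ _ hM =>
    ⟨bijective_eval_of_injective_eval h M hM, hM, fun i hi => ?_⟩⟩
  obtain ⟨j, rfl⟩ := Nat.exists_eq_succ_of_ne_zero hi.ne'
  exact subsingleton_ext_dual_of_injective_eval h M hM j

theorem theorem3p4 (R : Type u) [CommRing R] [IsNoetherianRing R] [IsLocalRing R]
    (hR : 0 < moduleDepth R R) :
    (SatisfiesTR R ↔
      ∀ (M : Type u) [AddCommGroup M] [Module R M] [Module.Finite R M],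
        ExtPosVanishes R M → 0 < moduleDepth R M) ∧
    (ArayaAffirmative R ↔ SatisfiesTR R) := by
  have tr_iff : SatisfiesTR R ↔
      ∀ (M : Type u) [AddCommGroup M] [Module R M] [Module.Finite R M],
        ExtPosVanishes R M → 0 < moduleDepth R M := by
    rw [satisfiesTR_iff_injective_eval]
    constructor
    · intro h M _ _ _ hM
      obtain ⟨x, hx, hxR⟩ := moduleDepth_pos_iff_exists_isSMulRegular.1 hR
      exact moduleDepth_pos_iff_exists_isSMulRegular.2
        ⟨x, hx, isSMulRegular_of_injective_eval hxR (h M hM)⟩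
    · refine fun h => injective_eval_of_exists_isSMulRegular fun M _ _ _ hM => ?_
      rw [IsLocalRing.ringJacobson_eq_maximalIdeal]
      exact moduleDepth_pos_iff_exists_isSMulRegular.1 (h M hM)
  exact ⟨tr_iff, fun h => tr_iff.2 (h hR), fun h _ => tr_iff.1 h⟩
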